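/- **Setting.** Let $E$ be a (standard) Borel space and $Q$ a semi-Markov kernel on $\mathbb R_+\times E$ given $E$: writing $Q(t,B|x)=Q([0,t]\times B|x)$, for each $x$ and $B$ the function $Q(\cdot,B|x)$ is non-decreasing and right-continuous with $Q(0,B|x)=0$; $Q(t,\cdot|\cdot)$ is a sub-stochastic kernel for each $t\in\mathbb R_+$, and $\lim_{t\to\infty}Q(t,\cdot|\cdot)$ is a stochastic kernel. On $\Omega=\{(x_0,t_1,x_1,t_2,x_2,\dots)\}$ let $X_n=x_n$, $T_0=0$, $T_n=t_n$ ($n\ge1$), $S_n=\sum_{k=0}^nT_k$, $\mathcal F_n=\sigma(T_0,X_0,\dots,T_n,X_n)$, and let $\mathbb P_x$ be the probability measure (Ionescu-Tulcea) with $\mathbb P_x(X_0=x)=1$ and $\mathbb P_x(T_{n+1}\le t,X_{n+1}\in B\mid T_0,X_0,\dots,T_n,X_n)=Q(t,B|X_n)$. Put $X(t)=X_n$ for $S_n\le t<S_{n+1}$. A stopping time is a map $\tau:\Omega\to\mathbb N\cup\{\infty\}$ with $\{\tau=n\}\in\mathcal F_n$ for all $n\in\mathbb N$. Let $c,g:E\to[0,\infty)$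 be measurable (cost rate and terminal cost) and fix a horizon $T\in[0,\infty)$. The cost of a stopping time $\tau$ is $R^T_\tau=\int_0^{S_\tau}c(X(t))\,dt+g(X(S_\tau))$ if $S_\tau<T$, and $R^T_\tau=\int_0^Tc(X(t))\,dt$ if $S_\tau\ge T$ (with $S_\infty=\infty$). Let $V^\tau(T,x)=\mathbb E_x[R^T_\tau]$ and $V^*(T,x)=\inf_\tau V^\tau(T,x)$, the infimum being over all stopping times. A stopping time $\tau$ is *$T$-optimal* if $V^\tau(T,x)=V^*(T,x)$ for all $x\in E$, and *$\varepsilon$-$T$-optimal* if $V^\tau(T,x)-V^*(T,x)\le\varepsilon$ for all $x\in E$. For measurable $u:[0,T]\times E\to[0,\infty]$ let $$\mathbb Gu(s,x)=\min\Big\{c(x)\int_0^s(1-Q(t,E|x))\,dt+\int_E\int_{[0,s]}u(s-t,y)\,Q(dt,dy|x),\ g(x)\Big\},$$ and let $V^*_0\equiv0$, $V^*_{n+1}=\mathbb GV^*_n$. **Theorem.** Suppose that $c$ and $g$ are bounded and that $\beta:=\sup_{x\in E}Q(T,E|x)<1$. Let $\varepsilon>0$, $M=T\|c\|+\|g\|$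 (sup norms) and $$N_\varepsilon=\left\lceil\frac{\log(\varepsilon(1-\beta))-\log(M+1)}{\log\beta}\right\rceil,$$ where $\lceil r\rceil=\min\{n\in\mathbb N: n\ge r\}$ (so $\lceil r\rceil=0$ for $r\le0$), and $N_\varepsilon=0$ if $\beta=0$. Let $$D^\varepsilon=\{(s,x)\in(0,T]\times E:\ g(x)=\mathbb GV^*_{N_\varepsilon}(s,x)\},$$ $$\tau^\varepsilon=\inf\{n:(T-S_n,X_n)\in D^\varepsilon\}\wedge\inf\{n:T\le S_n\},\qquad \inf\emptyset=\infty.$$ (a) $\tau^\varepsilon$ is a stopping time and is $\varepsilon$-$T$-optimal. (b) If $\displaystyle\inf_{(s,x)\in((0,T]\times E)\setminus D^\varepsilon}\big(g(x)-\mathbb GV^*_{N_\varepsilon}(s,x)\big)>\varepsilon$ (the infimum over the empty set being $+\infty$), then $\tau^\varepsilon$ is $T$-optimal. -/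

import Mathlib

open MeasureTheory ProbabilityTheory
open scoped NNReal ENNReal

namespace SemiMarkovStopping

/-- A semi-Markov kernel on `ℝ₊ × E` given `E`: for each state `x`, the joint law of the sojourn
time in `x` and of the next state, the sojourn time being almost surely positive.
In terms of `Q(t, B | x)` (see `SemiMarkovKernel.Q`): `Q(·, B | x)` is non-decreasing and
right-continuous with `Q(0, B | x) = 0`, `Q(t, · | ·)` is a sub-stochastic kernel and
`lim_{t → ∞} Q(t, · | ·)` is a stochastic kernel. -/
structure SemiMarkovKernel (E : Type*) [MeasurableSpace E] where
  kernel : Kernel E (ℝ≥0 × E)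
  isMarkov : IsMarkovKernel kernel
  kernel_zero : ∀ x, kernel x {p | p.1 = 0} = 0

attribute [instance] SemiMarkovKernel.isMarkov

variable {E : Type*}

/-- The sample space of sequences `ω = (x₀, t₁, x₁, t₂, x₂, …)`; the pair `(t_{n+1}, x_{n+1})` is
`ω.2 n`. It carries the product σ-algebra. -/
abbrev Path (E : Type*) : Type _ := E × (ℕ → ℝ≥0 × E)

/-- The state `X_n` at the `n`-th jump. -/
def state : ℕ → Path E → E
  | 0, ω => ω.1
  | n + 1, ω => (ω.2 n).2

/-- The sojourn time `T_n` between the `(n-1)`-th and the `n`-th jump; `T_0 = 0`. -/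
def sojourn : ℕ → Path E → ℝ≥0
  | 0, _ => 0
  | n + 1, ω => (ω.2 n).1

/-- The `n`-th jump time `S_n = T_0 + ⋯ + T_n`. -/
noncomputable def jumpTime (n : ℕ) (ω : Path E) : ℝ≥0 :=
  ∑ k ∈ Finset.range (n + 1), sojourn k ω

open Classical in
/-- The continuous-time state process: `X(t) = X_n` for `S_n ≤ t < S_{n+1}`. (For `t` not below
`lim S_n` the value is irrelevant and set to `X_0`.) -/
noncomputable def process (t : ℝ) (ω : Path E) : E :=
  if h : ∃ n, (jumpTime n ω : ℝ) ≤ t ∧ t < (jumpTime (n + 1) ω : ℝ) then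
    state (Nat.find h) ω
  else state 0 ω

variable [MeasurableSpace E]

lemma measurable_state : ∀ n, Measurable (state n : Path E → E)
  | 0 => measurable_fst
  | n + 1 => measurable_snd.comp ((measurable_pi_apply n).comp measurable_snd)

lemma measurable_sojourn : ∀ n, Measurable (sojourn n : Path E → ℝ≥0)
  | 0 => measurable_const
  | n + 1 => measurable_fst.comp ((measurable_pi_apply n).comp measurable_snd)

/-- The filtration `σ(T_0, X_0, …, T_n, X_n)`. -/
def historyFiltration (E : Type*) [MeasurableSpace E] :
    Filtration ℕ (inferInstance : MeasurableSpace (Path E)) where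
  seq n := ⨆ k ≤ n, MeasurableSpace.comap (fun ω : Path E => (sojourn k ω, state k ω)) inferInstance
  mono' _ _ hmn := iSup₂_mono' fun k hk => ⟨k, hk.trans hmn, le_rfl⟩
  le' _ := iSup₂_le fun k _ => ((measurable_sojourn k).prodMk (measurable_state k)).comap_le

namespace SemiMarkovKernel

/-- `Q(t, B | x)`, the probability that the sojourn time in `x` is at most `t` and the next
state is in `B`. -/
noncomputable def Q (K : SemiMarkovKernel E) (t : ℝ) (B : Set E) (x : E) : ℝ≥0∞ :=
  K.kernel x {p | (p.1 : ℝ) ≤ t ∧ p.2 ∈ B}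

/-- The conditional law of `(T_{n+1}, X_{n+1})` given `(T_0, X_0, …, T_n, X_n)`: it is
`Q(dt, dy | X_n)`. -/
noncomputable def step (K : SemiMarkovKernel E) (n : ℕ) :
    Kernel (Finset.Iic n → ℝ≥0 × E) (ℝ≥0 × E) :=
  K.kernel.comap (fun h => (h ⟨n, Finset.mem_Iic.2 le_rfl⟩).2)
    (measurable_snd.comp (measurable_pi_apply _))

instance (K : SemiMarkovKernel E) (n : ℕ) : IsMarkovKernel (K.step n) := by
  unfold step; infer_instance

/-- The law `ℙ_x` on the sample space, given by the Ionescu-Tulcea theorem: `X_0 = x` and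
`(T_{n+1}, X_{n+1})` has conditional law `Q(dt, dy | X_n)` given the past. -/
noncomputable def law (K : SemiMarkovKernel E) (x : E) : Measure (Path E) :=
  (Kernel.traj (X := fun _ : ℕ => ℝ≥0 × E) K.step 0 (fun _ => (0, x))).map
    (fun z => ((z 0).2, fun n => z (n + 1)))

end SemiMarkovKernel

open Classical in
/-- The cost `R_τ^T`: if `S_τ < T`, the running cost at rate `c` until `S_τ` plus the terminal cost
`g(X(S_τ))`; if `S_τ ≥ T`, only the running cost on `[0, T]`. On `{τ = ∞}` one never stops, and
`S_τ` counts as infinite. -/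
noncomputable def pathCost (c g : E → ℝ≥0) (T : ℝ≥0) (τ : Path E → ℕ∞) (ω : Path E) : ℝ≥0∞ :=
  if τ ω ≠ ⊤ ∧ jumpTime (τ ω).toNat ω < T then
    (∫⁻ t in Set.Icc (0 : ℝ) (jumpTime (τ ω).toNat ω), (c (process t ω) : ℝ≥0∞))
      + (g (process (jumpTime (τ ω).toNat ω) ω) : ℝ≥0∞)
  else ∫⁻ t in Set.Icc (0 : ℝ) T, (c (process t ω) : ℝ≥0∞)

/-- The `T`-horizon expected cost `V^τ(T, x) = 𝔼_x[R_τ^T]`. -/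
noncomputable def expectedCost (K : SemiMarkovKernel E) (c g : E → ℝ≥0) (τ : Path E → ℕ∞)
    (T : ℝ≥0) (x : E) : ℝ≥0∞ :=
  ∫⁻ ω, pathCost c g T τ ω ∂(K.law x)

/-- The value function `V^*(T, x) = inf_τ V^τ(T, x)`, over all stopping times. -/
noncomputable def value (K : SemiMarkovKernel E) (c g : E → ℝ≥0) (T : ℝ≥0) (x : E) : ℝ≥0∞ :=
  ⨅ (τ : Path E → ℕ∞) (_ : IsStoppingTime (historyFiltration E) τ), expectedCost K c g τ T x

/-- `τ` is a `T`-optimal stopping time. -/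
def IsOptimal (K : SemiMarkovKernel E) (c g : E → ℝ≥0) (T : ℝ≥0) (τ : Path E → ℕ∞) : Prop :=
  IsStoppingTime (historyFiltration E) τ ∧
    ∀ x, expectedCost K c g τ T x = value K c g T x

/-- `τ` is an `ε`-`T`-optimal stopping time. -/
def IsEpsOptimal (K : SemiMarkovKernel E) (c g : E → ℝ≥0) (T : ℝ≥0) (ε : ℝ)
    (τ : Path E → ℕ∞) : Prop :=
  IsStoppingTime (historyFiltration E) τ ∧
    ∀ x, expectedCost K c g τ T x ≤ value K c g T x + ENNReal.ofReal ε

/-- The operator `𝔾`: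
`𝔾u(s,x) = min {c(x) ∫₀ˢ (1 - Q(t,E|x)) dt + ∫_E ∫_[0,s] u(s-t,y) Q(dt,dy|x), g(x)}`.
The value at `(s, x)` only involves `u` on `[0, s] × E`, so the functions are taken on
`ℝ₊ × E` and need not be cut off at the horizon. -/
noncomputable def opG (K : SemiMarkovKernel E) (c g : E → ℝ≥0) (u : ℝ≥0 → E → ℝ≥0∞)
    (s : ℝ≥0) (x : E) : ℝ≥0∞ :=
  min ((c x : ℝ≥0∞) * (∫⁻ t in Set.Icc (0 : ℝ) s, (1 - K.Q t Set.univ x))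
      + ∫⁻ p in {p : ℝ≥0 × E | p.1 ≤ s}, u (s - p.1) p.2 ∂(K.kernel x))
    (g x : ℝ≥0∞)

/-- The value iterates: `V^*_0 = 0`, `V^*_{n+1} = 𝔾 V^*_n`. -/
noncomputable def valueIter (K : SemiMarkovKernel E) (c g : E → ℝ≥0) : ℕ → ℝ≥0 → E → ℝ≥0∞
  | 0 => fun _ _ => 0
  | n + 1 => opG K c g (valueIter K c g n)

/-- The set `{(s, x) ∈ (0, T] × E : g(x) = 𝔾 V^*_N(s, x)}`. -/
def stopSet (K : SemiMarkovKernel E) (c g : E → ℝ≥0) (T : ℝ≥0) (N : ℕ) : Set (ℝ≥0 × E) :=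
  {p | p.1 ∈ Set.Ioc 0 T ∧ (g p.2 : ℝ≥0∞) = opG K c g (valueIter K c g N) p.1 p.2}

/-- `inf {n | (T - S_n, X_n) ∈ D} ∧ inf {n | T ≤ S_n}` with `inf ∅ = ∞`. -/
noncomputable def hittingTime (T : ℝ≥0) (D : Set (ℝ≥0 × E)) (ω : Path E) : ℕ∞ :=
  (⨅ (n : ℕ) (_ : jumpTime n ω ≤ T ∧ (T - jumpTime n ω, state n ω) ∈ D), (n : ℕ∞)) ⊓
    ⨅ (n : ℕ) (_ : T ≤ jumpTime n ω), (n : ℕ∞)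

end SemiMarkovStopping

/-!
Everything rests on conditioning on the first jump. The law `ℙ_x` decomposes as a draw of
`(T₁, X₁)` from `Q(dt, dy | x)` followed by a path with law `ℙ_y` (`SemiMarkovKernel.lintegral_law`,
proved by comparing the two measures on rectangles). As jumps before the horizon have probability
at most `β < 1`, almost every path has only finitely many of them, so that the path cost agrees
almost surely with a sum over the jumps, `stepCost`, whose first-step decomposition holds pathwise
(`pathCost_eq_stepCost`, `stepCost_cons`).

Two consequences follow. After the first jump a stopping time is again a stopping time of the path
that starts afresh, so by induction on `n` every stopping time costs at least `V*_n`
(`valueIter_le_lintegral_stepCost`), whence `V*_n ≤ V*`. The cost `f` of the hitting time of the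
stopping set satisfies `f ≤ g` on that set and the one-step equation off it
(`hittingCost_le_of_mem`, `hittingCost_eq_contCost`).

The cost of continuing is a `β`-contraction in the future cost (`contCost_le_add`), so the iterates
differ by at most `β ^ N ‖g‖` from the `N`-th on (`valueIter_le_add`), and `N` is chosen to
make `β (ε + β ^ N ‖g‖) ≤ ε`. Since `V*_{N+1}` satisfies the same equations as `f` with `V*_N` in
place of `f` on the right-hand side, contracting gives `f ≤ V*_{N+1} + ε ≤ V* + ε`. If the gap
`g - 𝔾V*_N` off the stopping set exceeds `ε`, then there the cost of continuing with any
later iterate is still at most `g`; hence `f` and all later iterates satisfy the same recursion, and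
`f ≤ V*_{N+1+k} + β ^ k B` for all `k`, so `f ≤ V*`. The limit of the iterates is never needed.
-/

namespace SemiMarkovStopping

section

variable {E : Type*} [MeasurableSpace E]

/-! ### The law of the sequence of jumps and its first-step decomposition -/

/-- The path that stays in `x` for the time `t`, then jumps to the initial state of `ω` and
continues as `ω`. -/
def Path.cons (x : E) (t : ℝ≥0) (ω : Path E) : Path E :=
  (x, fun n => Nat.casesOn n (t, ω.1) ω.2)

namespace SemiMarkovKernel

variable (K : SemiMarkovKernel E)

/-- The law of `(T₁, X₁, T₂, X₂, …)` for the chain started in `x`. -/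
noncomputable def jumpLaw : Kernel E (ℕ → ℝ≥0 × E) :=
  ((Kernel.traj (X := fun _ : ℕ => ℝ≥0 × E) K.step 0).comap (fun x _ => (0, x))
    (by fun_prop)).map (fun z n => z (n + 1))

instance : IsMarkovKernel K.jumpLaw := by
  unfold jumpLaw
  exact Kernel.IsMarkovKernel.map _ (by fun_prop)

lemma jumpLaw_apply (x : E) : K.jumpLaw x =
    (Kernel.traj (X := fun _ : ℕ => ℝ≥0 × E) K.step 0 (fun _ => (0, x))).map
      (fun z n => z (n + 1)) := by
  rw [jumpLaw, Kernel.map_apply _ (by fun_prop), Kernel.comap_apply]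

lemma measurable_casesOn :
    Measurable fun q : (ℝ≥0 × E) × (ℕ → ℝ≥0 × E) =>
      (fun n => Nat.casesOn n q.1 q.2 : ℕ → ℝ≥0 × E) := by
  refine measurable_pi_lambda _ fun n => ?_
  cases n with
  | zero => exact measurable_fst
  | succ n => exact (measurable_pi_apply n).comp measurable_snd

lemma measurable_cons (x : E) : Measurable fun q : ℝ≥0 × Path E => Path.cons x q.1 q.2 := by
  refine measurable_const.prodMk (measurable_pi_lambda _ fun n => ?_)
  cases n with
  | zero => exact measurable_fst.prodMk measurable_snd.fst
  | succ n => exact (measurable_pi_apply n).comp measurable_snd.snd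

/-- The expectation of `∏_{k < n} f k (T_{k+1}, X_{k+1})`, computed by conditioning on the
first jump. -/
noncomputable def prodExpect : ℕ → (ℕ → ℝ≥0 × E → ℝ≥0∞) → E → ℝ≥0∞
  | 0, _, _ => 1
  | n + 1, f, x => ∫⁻ p, f 0 p * prodExpect n (fun k => f (k + 1)) p.2 ∂(K.kernel x)

/-- The recursion of `prodExpect` at the last factor instead of the first. -/
lemma prodExpect_succ_last (n : ℕ) (f : ℕ → ℝ≥0 × E → ℝ≥0∞) :
    K.prodExpect (n + 2) f = K.prodExpect (n + 1)
      (Function.update f n fun p => f n p * ∫⁻ q, f (n + 1) q ∂(K.kernel p.2)) := by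
  induction n generalizing f with
  | zero => ext x; simp [prodExpect]
  | succ n ih =>
    ext x
    rw [prodExpect, ih]
    conv_rhs => rw [prodExpect]
    refine lintegral_congr fun p => ?_
    congr 2
    ext k
    rcases eq_or_ne k n with rfl | hk
    · simp
    · simp [hk]

variable [MeasurableSingletonClass E]

lemma traj_zero_ae (x : E) :
    ∀ᵐ z ∂(Kernel.traj (X := fun _ : ℕ => ℝ≥0 × E) K.step 0 (fun _ => (0, x))), z 0 = (0, x) := by
  have hm : MeasurableSet {z : ℕ → ℝ≥0 × E | z 0 = (0, x)} :=
    measurableSet_preimage (measurable_pi_apply 0) (measurableSet_singleton _)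
  rw [← Kernel.traj_map_updateFinset, ae_map_iff measurable_updateFinset_left.aemeasurable hm]
  exact Filter.Eventually.of_forall fun z => by simp [Function.updateFinset]

lemma law_eq_map (x : E) : K.law x = (K.jumpLaw x).map (Prod.mk x) := by
  rw [law, jumpLaw_apply, Measure.map_map (by fun_prop) (by fun_prop)]
  refine Measure.map_congr ?_
  filter_upwards [K.traj_zero_ae x] with z hz
  simp [hz]

instance (x : E) : IsProbabilityMeasure (K.law x) := by
  rw [law_eq_map]
  exact Measure.isProbabilityMeasure_map (by fun_prop)

/-- One transition: given the first `n` jumps, the next one has the law `Q(dt, dy | X_n)`. -/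
lemma lintegral_jumpLaw_prod_mul (x : E) (n : ℕ) (f : ℕ → ℝ≥0 × E → ℝ≥0∞)
    (hf : ∀ k, Measurable (f k)) (φ : ℝ≥0 × E → ℝ≥0∞) (hφ : Measurable φ) :
    ∫⁻ z, (∏ k ∈ Finset.range n, f k (z k)) * φ (z n) ∂(K.jumpLaw x) =
      ∫⁻ z, (∏ k ∈ Finset.range n, f k (z k)) *
        (∫⁻ p, φ p ∂(K.kernel (state n (x, z)))) ∂(K.jumpLaw x) := by
  have hst : Measurable fun z : ℕ → ℝ≥0 × E => state n (x, z) :=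
    (measurable_state n).comp measurable_prodMk_left
  have hP : Measurable fun z : ℕ → ℝ≥0 × E => ∏ k ∈ Finset.range n, f k (z k) := by fun_prop
  have hI : Measurable fun y => ∫⁻ p, φ p ∂(K.kernel y) := hφ.lintegral_kernel
  have hPI : Measurable fun z : ℕ → ℝ≥0 × E => (∏ k ∈ Finset.range n, f k (z k)) *
      (∫⁻ p, φ p ∂(K.kernel (state n (x, z)))) := hP.mul (hI.comp hst)
  have key := Kernel.partialTraj_compProd_eq_map_traj (X := fun _ : ℕ => ℝ≥0 × E)
    (κ := K.step) (Nat.zero_le n) (x₀ := fun _ => (0, x))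
  set μ := Kernel.traj (X := fun _ : ℕ => ℝ≥0 × E) K.step 0 (fun _ => (0, x)) with hμ
  rw [jumpLaw_apply, ← hμ, lintegral_map (by fun_prop) (by fun_prop),
    lintegral_map hPI (by fun_prop)]
  -- The product as a function of the trajectory up to time `n`, whose coordinate `0` is `(0, x)`.
  let F : (Finset.Iic n → ℝ≥0 × E) → ℝ≥0∞ := fun h =>
    ∏ k : Fin n, f k (h ⟨k + 1, Finset.mem_Iic.2 k.2⟩)
  have hF : Measurable F := by fun_prop
  have h1 : ∀ z : ℕ → ℝ≥0 × E, F (Preorder.frestrictLe n z) =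
      ∏ k ∈ Finset.range n, f k (z (k + 1)) := fun z => by
    rw [Finset.prod_range]; rfl
  have h2 : ∫⁻ z, (∏ k ∈ Finset.range n, f k (z (k + 1))) * φ (z (n + 1)) ∂μ =
      ∫⁻ q, F q.1 * φ q.2 ∂(μ.map fun z => (Preorder.frestrictLe n z, z (n + 1))) := by
    rw [lintegral_map (by fun_prop) (by fun_prop)]
    simp only [h1]
  rw [h2, ← key, Measure.lintegral_compProd (by fun_prop)]
  have h3 : Kernel.partialTraj (X := fun _ : ℕ => ℝ≥0 × E) K.step 0 n (fun _ => (0, x)) =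
      μ.map (Preorder.frestrictLe n) := (Kernel.traj_map_frestrictLe_apply ..).symm
  rw [h3, lintegral_map _ (by fun_prop)]
  · refine lintegral_congr_ae ?_
    filter_upwards [K.traj_zero_ae x] with z hz
    rw [lintegral_const_mul _ hφ, h1]
    congr 2
    cases n with
    | zero => simp [step, Kernel.comap_apply, hz, state]
    | succ n => simp [step, Kernel.comap_apply, state]
  · exact Measurable.lintegral_kernel_prod_right' (κ := K.step n)
      (f := fun q => F q.1 * φ q.2) (by fun_prop)

/-- The joint laws of finitely many jumps. The induction conditions on all jumps but the last, as
the Ionescu-Tulcea construction provides, whereas `prodExpect` conditions on the first one. -/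
lemma lintegral_jumpLaw_prod (x : E) (n : ℕ) (f : ℕ → ℝ≥0 × E → ℝ≥0∞)
    (hf : ∀ k, Measurable (f k)) :
    ∫⁻ z, ∏ k ∈ Finset.range n, f k (z k) ∂(K.jumpLaw x) = K.prodExpect n f x := by
  induction n generalizing f with
  | zero => simp [prodExpect]
  | succ n ih =>
    simp only [Finset.prod_range_succ]
    rw [K.lintegral_jumpLaw_prod_mul x n f hf _ (hf n)]
    cases n with
    | zero => simp [prodExpect, state]
    | succ n =>
      have hg : Measurable fun p : ℝ≥0 × E => f n p * ∫⁻ q, f (n + 1) q ∂(K.kernel p.2) :=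
        (hf n).mul ((hf (n + 1)).lintegral_kernel.comp measurable_snd)
      rw [prodExpect_succ_last, ← ih]
      · refine lintegral_congr fun z => ?_
        rw [Finset.prod_range_succ, Finset.prod_range_succ, Function.update_self, mul_assoc]
        congr 1
        refine Finset.prod_congr rfl fun k hk => ?_
        rw [Function.update_of_ne (Finset.mem_range.1 hk).ne]
      · intro k
        rcases eq_or_ne k n with rfl | hk
        · simpa using hg
        · simpa [hk] using hf k

/-- The Markov property at the first jump. Both sides are probability measures that agree on
rectangles by `lintegral_jumpLaw_prod`. -/
lemma jumpLaw_eq_map_compProd (x : E) :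
    K.jumpLaw x = (K.kernel x ⊗ₘ K.jumpLaw.comap Prod.snd measurable_snd).map
      (fun q n => Nat.casesOn n q.1 q.2) := by
  have : IsProbabilityMeasure ((K.kernel x ⊗ₘ K.jumpLaw.comap Prod.snd measurable_snd).map
      (fun q : (ℝ≥0 × E) × (ℕ → ℝ≥0 × E) => (fun n => Nat.casesOn n q.1 q.2 : ℕ → ℝ≥0 × E))) :=
    Measure.isProbabilityMeasure_map measurable_casesOn.aemeasurable
  refine ext_of_generate_finite _ generateFrom_squareCylinders.symm
    (isPiSystem_squareCylinders (fun _ => MeasurableSpace.isPiSystem_measurableSet) (by simp))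
    ?_ (by simp)
  rintro _ ⟨s, t, ht, rfl⟩
  simp only [Set.mem_pi, Set.mem_univ, Set.mem_ofPred_eq, forall_const] at ht
  have hS : MeasurableSet ((s : Set ℕ).pi t) := MeasurableSet.pi s.countable_toSet fun i _ => ht i
  classical
  let f : ℕ → ℝ≥0 × E → ℝ≥0∞ := fun k => if k ∈ s then (t k).indicator 1 else 1
  have hf : ∀ k, Measurable (f k) := fun k => by
    by_cases hk : k ∈ s
    · simpa [f, hk] using measurable_one.indicator (ht k)
    · simpa [f, hk] using measurable_one
  obtain ⟨n, hn⟩ : ∃ n, s ⊆ Finset.range (n + 1) :=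
    ⟨s.sup id, fun k hk => Finset.mem_range.2 (Nat.lt_succ_of_le (Finset.le_sup (f := id) hk))⟩
  have hind : ∀ z : ℕ → ℝ≥0 × E, ((s : Set ℕ).pi t).indicator (1 : (ℕ → ℝ≥0 × E) → ℝ≥0∞) z =
      ∏ k ∈ Finset.range (n + 1), f k (z k) := by
    intro z
    by_cases hz : z ∈ (s : Set ℕ).pi t
    · rw [Set.indicator_of_mem hz]
      refine (Finset.prod_eq_one fun k _ => ?_).symm
      by_cases hk : k ∈ s
      · simp [f, hk, hz k hk]
      · simp [f, hk]
    · rw [Set.indicator_of_notMem hz]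
      simp only [Set.mem_pi, not_forall] at hz
      obtain ⟨k, hk, hzk⟩ := hz
      refine (Finset.prod_eq_zero (hn hk) ?_).symm
      have hk' : k ∈ s := hk
      simp [f, hk', hzk]
  have hprod : ∀ n, Measurable fun z : ℕ → ℝ≥0 × E => ∏ k ∈ Finset.range n, f k (z k) :=
    fun n => by fun_prop
  have hprod' : Measurable fun q : (ℝ≥0 × E) × (ℕ → ℝ≥0 × E) =>
      ∏ k ∈ Finset.range (n + 1), f k ((fun n => Nat.casesOn n q.1 q.2 : ℕ → ℝ≥0 × E) k) :=
    (hprod _).comp measurable_casesOn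
  rw [← lintegral_indicator_one hS, ← lintegral_indicator_one hS]
  simp only [hind]
  rw [lintegral_jumpLaw_prod _ _ _ _ hf, lintegral_map (hprod _) measurable_casesOn,
    Measure.lintegral_compProd hprod', prodExpect]
  refine lintegral_congr fun p => ?_
  have hprod0 : Measurable fun z : ℕ → ℝ≥0 × E => ∏ k ∈ Finset.range n, f (k + 1) (z k) :=
    by fun_prop
  simp only [Finset.prod_range_succ']
  change _ = ∫⁻ z : ℕ → ℝ≥0 × E, (∏ k ∈ Finset.range n, f (k + 1) (z k)) * f 0 p ∂_
  rw [lintegral_mul_const _ hprod0, mul_comm, Kernel.comap_apply,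
    ← lintegral_jumpLaw_prod _ _ _ _ fun k => hf (k + 1)]

/-- The first-step decomposition of expectations. -/
lemma lintegral_law (x : E) (Φ : Path E → ℝ≥0∞) (hΦ : Measurable Φ) :
    ∫⁻ ω, Φ ω ∂(K.law x) =
      ∫⁻ p, ∫⁻ ω, Φ (Path.cons x p.1 ω) ∂(K.law p.2) ∂(K.kernel x) := by
  have h1 : Measurable fun z : ℕ → ℝ≥0 × E => Φ (x, z) := hΦ.comp measurable_prodMk_left
  have h2 : Measurable fun q : (ℝ≥0 × E) × (ℕ → ℝ≥0 × E) =>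
      Φ (x, fun n => Nat.casesOn n q.1 q.2) := h1.comp measurable_casesOn
  rw [law_eq_map, lintegral_map hΦ (by fun_prop), jumpLaw_eq_map_compProd,
    lintegral_map h1 measurable_casesOn,
    Measure.lintegral_compProd h2]
  refine lintegral_congr fun p => ?_
  have h3 : Measurable fun ω => Φ (Path.cons x p.1 ω) :=
    (hΦ.comp (measurable_cons x)).comp measurable_prodMk_left
  rw [law_eq_map, lintegral_map h3 (by fun_prop), Kernel.comap_apply]
  rfl

end SemiMarkovKernel

end

section

variable {E : Type*}

/-! ### The cost as a sum over the jumps -/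

@[simp] lemma state_zero_cons (x : E) (t : ℝ≥0) (ω : Path E) : state 0 (Path.cons x t ω) = x := rfl

@[simp] lemma state_succ_cons (x : E) (t : ℝ≥0) (ω : Path E) (n : ℕ) :
    state (n + 1) (Path.cons x t ω) = state n ω := by
  cases n <;> rfl

@[simp] lemma jumpTime_zero (ω : Path E) : jumpTime 0 ω = 0 := by simp [jumpTime, sojourn]

lemma jumpTime_succ (n : ℕ) (ω : Path E) :
    jumpTime (n + 1) ω = jumpTime n ω + sojourn (n + 1) ω := by
  rw [jumpTime, Finset.sum_range_succ, ← jumpTime]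

@[simp] lemma jumpTime_succ_cons (x : E) (t : ℝ≥0) (ω : Path E) (n : ℕ) :
    jumpTime (n + 1) (Path.cons x t ω) = t + jumpTime n ω := by
  induction n with
  | zero => simp [jumpTime_succ, sojourn, Path.cons]
  | succ n ih =>
    rw [jumpTime_succ, ih, jumpTime_succ n ω, add_assoc]
    rfl

lemma jumpTime_mono (ω : Path E) : Monotone fun n => jumpTime n ω :=
  monotone_nat_of_le_succ fun n => by rw [jumpTime_succ]; exact le_self_add

/-- The index selected by `process` is unique, since the jump times are monotone. -/
lemma process_eq_state {t : ℝ} {ω : Path E} {n : ℕ} (h1 : (jumpTime n ω : ℝ) ≤ t)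
    (h2 : t < jumpTime (n + 1) ω) : process t ω = state n ω := by
  classical
  have h : ∃ n, (jumpTime n ω : ℝ) ≤ t ∧ t < (jumpTime (n + 1) ω : ℝ) := ⟨n, h1, h2⟩
  rw [process, dif_pos h]
  have hm := Nat.find_spec h
  congr 1
  refine le_antisymm (Nat.find_min' h ⟨h1, h2⟩) (not_lt.1 fun hlt => ?_)
  have : (jumpTime (Nat.find h + 1) ω : ℝ) ≤ jumpTime n ω := by
    exact_mod_cast jumpTime_mono ω (Nat.succ_le_of_lt hlt)
  linarith [hm.2]

open Classical in
/-- The cost of `τ` up to the horizon `s`, written jump by jump: the `n`-th sojourn is charged for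
the part of `[S_n, S_{n+1}]` that lies in `[0, s]` if `n < τ`, and the terminal cost is charged at
`n = τ` if `S_n < s`. Unlike `pathCost` it is visibly measurable, and its first-step
decomposition holds on all paths. -/
noncomputable def stepCost (c g : E → ℝ≥0) (s : ℝ≥0) (τ : Path E → ℕ∞) (ω : Path E) : ℝ≥0∞ :=
  ∑' n : ℕ, ((if (n : ℕ∞) < τ ω then
      (c (state n ω) : ℝ≥0∞) * ((min (jumpTime (n + 1) ω) s - min (jumpTime n ω) s : ℝ≥0) : ℝ≥0∞)
      else 0)
    + if τ ω = n ∧ jumpTime n ω < s then (g (state n ω) : ℝ≥0∞) else 0)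

lemma stepCost_of_eq_zero (c g : E → ℝ≥0) (s : ℝ≥0) (τ : Path E → ℕ∞) (ω : Path E)
    (h : τ ω = 0) : stepCost c g s τ ω = if 0 < s then (g (state 0 ω) : ℝ≥0∞) else 0 := by
  rw [stepCost, tsum_eq_single 0]
  · simp [h]
  · intro n hn
    have : ¬ ((0 : ℕ∞) = n) := by exact_mod_cast hn.symm
    simp [h, this]

/-- After a first jump at time `t` the horizon `s` shrinks to `s - t`. The subtraction truncates:
if `t ≥ s` the remaining horizon is `0`, and so is the remaining cost. -/
lemma stepCost_cons (c g : E → ℝ≥0) (s : ℝ≥0) (τ τ' : Path E → ℕ∞) (x : E) (t : ℝ≥0)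
    (ω : Path E) (h : τ (Path.cons x t ω) = τ' ω + 1) :
    stepCost c g s τ (Path.cons x t ω) =
      (c x : ℝ≥0∞) * (min t s : ℝ≥0) + stepCost c g (s - t) τ' ω := by
  rw [stepCost, tsum_eq_zero_add' ENNReal.summable]
  congr 1
  · have h0 : (0 : ℕ∞) < τ' ω + 1 := by simp
    simp [h, h0]
  · refine tsum_congr fun n => ?_
    have hlt : ((n + 1 : ℕ) : ℕ∞) < τ' ω + 1 ↔ (n : ℕ∞) < τ' ω := by
      push_cast
      exact ENat.add_lt_add_iff_right ENat.one_ne_top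
    have heq : τ' ω + 1 = ((n + 1 : ℕ) : ℕ∞) ↔ τ' ω = n := by
      push_cast
      exact (ENat.addLECancellable_of_ne_top ENat.one_ne_top).inj_left
    have hmin : ∀ a : ℝ≥0, min (t + a) s - min t s = min a (s - t) := fun a => by
      rcases le_total t s with hts | hts
      · rw [min_eq_left hts]
        nth_rw 1 [← add_tsub_cancel_of_le hts]
        rw [min_add_add_left, add_tsub_cancel_left]
      · rw [min_eq_right hts, min_eq_right (hts.trans le_self_add), tsub_eq_zero_of_le hts]
        simp
    have hdiff : min (t + jumpTime (n + 1) ω) s - min (t + jumpTime n ω) s =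
        min (jumpTime (n + 1) ω) (s - t) - min (jumpTime n ω) (s - t) := by
      rw [← hmin, ← hmin, tsub_tsub_tsub_cancel_right]
      exact min_le_min_right _ le_self_add
    have hs : t + jumpTime n ω < s ↔ jumpTime n ω < s - t := lt_tsub_iff_left.symm
    simp only [h, hlt, heq, jumpTime_succ_cons, state_succ_cons, hdiff, hs]

lemma stepCost_zero (c g : E → ℝ≥0) (τ : Path E → ℕ∞) (ω : Path E) :
    stepCost c g 0 τ ω = 0 := by
  simp [stepCost]

/-- The running cost up to `R`, provided the path does not explode before `R`. -/
lemma lintegral_process (c : E → ℝ≥0) (R : ℝ≥0) (ω : Path E) (h : ∃ n, R < jumpTime n ω) :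
    ∫⁻ t in Set.Icc (0 : ℝ) R, (c (process t ω) : ℝ≥0∞) =
      ∑' n : ℕ, (c (state n ω) : ℝ≥0∞) *
        ((min (jumpTime (n + 1) ω) R - min (jumpTime n ω) R : ℝ≥0) : ℝ≥0∞) := by
  let a : ℕ → ℝ := fun n => (min (jumpTime n ω) R : ℝ≥0)
  have ha : Monotone a := fun m n hmn => by
    exact NNReal.coe_le_coe.2 (min_le_min_right _ (jumpTime_mono ω hmn))
  have hU : Set.Ico (0 : ℝ) R = ⋃ n, Set.Ico (a n) (a (n + 1)) := by
    ext t
    simp only [Set.mem_iUnion, Set.mem_Ico]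
    constructor
    · rintro ⟨h0, h1⟩
      obtain ⟨m, hm⟩ := h
      have hex : ∃ n, t < a n := ⟨m, by
        have : a m = R := by simp only [a, min_eq_right hm.le]
        rwa [this]⟩
      classical
      have hpos : Nat.find hex ≠ 0 := fun h' => by
        have := Nat.find_spec hex
        rw [h'] at this
        simp [a] at this
        linarith
      obtain ⟨k, hk⟩ := Nat.exists_eq_succ_of_ne_zero hpos
      refine ⟨k, not_lt.1 (Nat.find_min hex (by omega)), ?_⟩
      have := Nat.find_spec hex
      rwa [hk] at this
    · rintro ⟨n, h0, h1⟩
      refine ⟨le_trans (NNReal.coe_nonneg _) h0, h1.trans_le ?_⟩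
      exact NNReal.coe_le_coe.2 (min_le_right _ _)
  rw [← restrict_Ico_eq_restrict_Icc, hU,
    lintegral_iUnion (fun _ => measurableSet_Ico)
      (by simpa using ha.pairwise_disjoint_on_Ico_succ)]
  refine tsum_congr fun n => ?_
  have : Set.EqOn (fun t => (c (process t ω) : ℝ≥0∞)) (fun _ => (c (state n ω) : ℝ≥0∞))
      (Set.Ico (a n) (a (n + 1))) := by
    rintro t ⟨h1, h2⟩
    have h3 : t < jumpTime (n + 1) ω := h2.trans_le (NNReal.coe_le_coe.2 (min_le_left _ _))
    have h4 : t < R := h2.trans_le (NNReal.coe_le_coe.2 (min_le_right _ _))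
    have h5 : (jumpTime n ω : ℝ) ≤ t := by
      simp only [a, NNReal.coe_min, min_le_iff] at h1
      rcases h1 with h1 | h1
      · exact h1
      · linarith
    simp only [process_eq_state h5 h3]
  rw [setLIntegral_congr_fun measurableSet_Ico this, setLIntegral_const, Real.volume_Ico]
  congr 1

/-- Positivity of the sojourn times gives `X(S_τ) = X_τ`, and a jump time beyond `s` makes the
sojourn intervals cover `[0, s]`. -/
lemma pathCost_eq_stepCost (c g : E → ℝ≥0) (s : ℝ≥0) (τ : Path E → ℕ∞) (ω : Path E)
    (hpos : ∀ n, 0 < sojourn (n + 1) ω) (h : ∃ n, s < jumpTime n ω) :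
    pathCost c g s τ ω = stepCost c g s τ ω := by
  rw [stepCost, ENNReal.tsum_add, pathCost]
  split_ifs with hτ
  · obtain ⟨m, hm⟩ := ENat.ne_top_iff_exists.1 hτ.1
    rw [← hm, ENat.toNat_natCast] at hτ ⊢
    congr 1
    · rw [lintegral_process _ _ _ (h.imp fun n hn => hτ.2.trans hn)]
      refine tsum_congr fun n => ?_
      split_ifs with hn
      · have hnm : n < m := by exact_mod_cast hn
        have h1 := jumpTime_mono ω hnm.le
        have h2 := jumpTime_mono ω (Nat.succ_le_of_lt hnm)
        simp only at h1 h2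
        rw [min_eq_left h1, min_eq_left h2, min_eq_left (h1.trans hτ.2.le),
          min_eq_left (h2.trans hτ.2.le)]
      · have hnm : m ≤ n := by exact_mod_cast not_lt.1 hn
        rw [min_eq_right (jumpTime_mono ω hnm),
          min_eq_right (jumpTime_mono ω (hnm.trans n.le_succ))]
        simp
    · rw [tsum_eq_single m, process_eq_state le_rfl]
      · simp [hτ.2]
      · rw [jumpTime_succ]
        exact_mod_cast lt_add_of_pos_right _ (hpos m)
      · intro n hn
        have : ¬ ((m : ℕ∞) = n) := by exact_mod_cast hn.symm
        simp [this]
  · -- Here `S_τ ≥ s`, so sojourns from `τ` on lie beyond the horizon and contribute nothing.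
    rw [lintegral_process _ _ _ h, ENNReal.tsum_eq_zero (f := fun n : ℕ =>
        if τ ω = n ∧ jumpTime n ω < s then (g (state n ω) : ℝ≥0∞) else 0) |>.2, add_zero]
    · refine tsum_congr fun n => ?_
      split_ifs with hn
      · rfl
      · have hτn : τ ω ≠ ⊤ := fun h' => hn (by rw [h']; exact ENat.natCast_lt_top n)
        obtain ⟨m, hm⟩ := ENat.ne_top_iff_exists.1 hτn
        have hsm : s ≤ jumpTime m ω := by
          rw [← hm] at hτ
          simpa using hτ
        have hnm : m ≤ n := by
          rw [← hm] at hn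
          exact_mod_cast not_lt.1 hn
        rw [min_eq_right (hsm.trans (jumpTime_mono ω hnm)),
          min_eq_right (hsm.trans (jumpTime_mono ω (hnm.trans n.le_succ)))]
        simp
    · intro n
      rw [if_neg]
      rintro ⟨h1, h2⟩
      exact hτ ⟨by simp [h1], by simpa [h1] using h2⟩

lemma pathCost_le (c g : E → ℝ≥0) (C G : ℝ≥0) (hC : ∀ x, c x ≤ C) (hG : ∀ x, g x ≤ G)
    (s : ℝ≥0) (τ : Path E → ℕ∞) (ω : Path E) : pathCost c g s τ ω ≤ C * s + G := by
  have key : ∀ R : ℝ≥0, R ≤ s →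
      ∫⁻ t in Set.Icc (0 : ℝ) R, (c (process t ω) : ℝ≥0∞) ≤ C * s := fun R hR => by
    calc ∫⁻ t in Set.Icc (0 : ℝ) R, (c (process t ω) : ℝ≥0∞)
        ≤ ∫⁻ t in Set.Icc (0 : ℝ) R, (C : ℝ≥0∞) :=
          lintegral_mono fun t => ENNReal.coe_le_coe.2 (hC _)
      _ = C * R := by simp
      _ ≤ C * s := by gcongr
  rw [pathCost]
  split_ifs with h
  · exact add_le_add (key _ h.2.le) (ENNReal.coe_le_coe.2 (hG _))
  · exact (key s le_rfl).trans le_self_add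

variable [MeasurableSpace E]

lemma measurable_jumpTime (n : ℕ) : Measurable (jumpTime n : Path E → ℝ≥0) :=
  Finset.measurable_sum _ fun k _ => measurable_sojourn k

lemma measurable_stepCost {c g : E → ℝ≥0} (hc : Measurable c) (hg : Measurable g) (s : ℝ≥0)
    {τ : Path E → ℕ∞} (hτ : IsStoppingTime (historyFiltration E) τ) :
    Measurable (stepCost c g s τ) := by
  refine Measurable.tsum fun n => Measurable.add ?_ ?_
  · refine Measurable.ite ?_ ?_ measurable_const
    · exact (historyFiltration E).le n _ (hτ.measurableSet_gt n)
    · exact (hc.comp (measurable_state n)).coe_nnreal_ennreal.mul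
        (((measurable_jumpTime (n + 1)).min measurable_const).sub
          ((measurable_jumpTime n).min measurable_const)).coe_nnreal_ennreal
  · refine Measurable.ite ?_ (hg.comp (measurable_state n)).coe_nnreal_ennreal measurable_const
    have h1 : MeasurableSet {ω : Path E | jumpTime n ω < s} :=
      measurableSet_lt (measurable_jumpTime n) measurable_const
    exact ((historyFiltration E).le n _ (hτ.measurableSet_eq n)).inter h1

namespace SemiMarkovKernel

variable [MeasurableSingletonClass E] (K : SemiMarkovKernel E)

lemma law_apply (x : E) {A : Set (Path E)} (hA : MeasurableSet A) :
    K.law x A = ∫⁻ p, K.law p.2 (Path.cons x p.1 ⁻¹' A) ∂(K.kernel x) := by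
  rw [← lintegral_indicator_one hA, lintegral_law _ _ _ (measurable_one.indicator hA)]
  refine lintegral_congr fun p => ?_
  have h1 : Measurable (Path.cons x p.1) := (measurable_cons x).comp measurable_prodMk_left
  rw [← lintegral_indicator_one (h1 hA)]
  rfl

lemma ae_sojourn_pos (x : E) : ∀ᵐ ω ∂(K.law x), ∀ n, 0 < sojourn (n + 1) ω := by
  rw [ae_all_iff]
  intro n
  have hm : ∀ n, MeasurableSet {ω : Path E | ¬ 0 < sojourn (n + 1) ω} := fun n =>
    (measurableSet_lt measurable_const (measurable_sojourn _)).compl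
  induction n generalizing x with
  | zero =>
    have h0 : ∀ᵐ p ∂(K.kernel x), p.1 ≠ 0 := by simpa [ae_iff] using K.kernel_zero x
    rw [ae_iff, law_apply _ _ (hm 0), ← lintegral_zero (μ := K.kernel x)]
    refine lintegral_congr_ae (h0.mono fun p hp => ?_)
    refine measure_mono_null (t := ∅) (fun ω hω => hω (pos_iff_ne_zero.2 hp)) measure_empty
  | succ n ih =>
    rw [ae_iff, law_apply _ _ (hm (n + 1))]
    have : ∀ p : ℝ≥0 × E, K.law p.2
        (Path.cons x p.1 ⁻¹' {ω : Path E | ¬ 0 < sojourn (n + 1 + 1) ω}) = 0 := fun p => ih p.2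
    rw [lintegral_congr this, lintegral_zero]

/-- Each sojourn exceeds `T` with probability at least `1 - b`, hence some sojourn does. -/
lemma ae_exists_lt_jumpTime (T : ℝ≥0) (b : ℝ≥0∞) (hb : b < 1)
    (hK : ∀ x, K.kernel x {p | p.1 ≤ T} ≤ b) (x : E) :
    ∀ᵐ ω ∂(K.law x), ∃ n, T < jumpTime n ω := by
  -- The probability that the first `n` sojourns do not exceed `T` is at most `b ^ n`.
  let A : ℕ → Set (Path E) := fun n => {ω | ∀ k < n, sojourn (k + 1) ω ≤ T}
  have hA : ∀ n, MeasurableSet (A n) := fun n => by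
    simp only [A, Set.ofPred_forall]
    exact MeasurableSet.iInter fun k => MeasurableSet.iInter fun _ =>
      measurableSet_le (measurable_sojourn _) measurable_const
  have hmT : MeasurableSet {p : ℝ≥0 × E | p.1 ≤ T} :=
    measurableSet_le measurable_fst measurable_const
  have hle : ∀ n x, K.law x (A n) ≤ b ^ n := by
    intro n
    induction n with
    | zero => intro x; simpa using prob_le_one
    | succ n ih =>
      intro x
      rw [law_apply _ _ (hA _)]
      calc ∫⁻ p, K.law p.2 (Path.cons x p.1 ⁻¹' A (n + 1)) ∂(K.kernel x)
          ≤ ∫⁻ p, {p : ℝ≥0 × E | p.1 ≤ T}.indicator (fun _ => b ^ n) p ∂(K.kernel x) := by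
            refine lintegral_mono fun p => ?_
            by_cases hp : p.1 ≤ T
            · rw [Set.indicator_of_mem (by exact hp)]
              refine (measure_mono ?_).trans (ih p.2)
              intro ω hω k hk
              have := hω (k + 1) (by omega)
              exact this
            · rw [Set.indicator_of_notMem (by exact hp)]
              refine (measure_mono (t := ∅) ?_).trans (by simp)
              intro ω hω
              exact hp (hω 0 n.succ_pos)
        _ ≤ b ^ (n + 1) := by
            rw [lintegral_indicator_const hmT, pow_succ]
            gcongr
            exact hK x
  rw [ae_iff]
  refine le_antisymm (ge_of_tendsto' (ENNReal.tendsto_pow_atTop_nhds_zero_of_lt_one hb)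
    fun n => ?_) bot_le
  refine (measure_mono ?_).trans (hle n x)
  intro ω hω k _
  simp only [Set.mem_ofPred_eq, not_exists, not_lt] at hω
  exact le_trans (by rw [jumpTime_succ]; exact le_add_self) (hω (k + 1))

end SemiMarkovKernel

lemma expectedCost_eq_lintegral_stepCost [MeasurableSingletonClass E] (K : SemiMarkovKernel E)
    (c g : E → ℝ≥0) (T : ℝ≥0) (b : ℝ≥0∞) (hb : b < 1) (hK : ∀ x, K.kernel x {p | p.1 ≤ T} ≤ b)
    (τ : Path E → ℕ∞) (s : ℝ≥0) (hs : s ≤ T) (x : E) :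
    expectedCost K c g τ s x = ∫⁻ ω, stepCost c g s τ ω ∂(K.law x) := by
  refine lintegral_congr_ae ?_
  filter_upwards [K.ae_sojourn_pos x, K.ae_exists_lt_jumpTime T b hb hK x] with ω h1 h2
  exact pathCost_eq_stepCost _ _ _ _ _ h1 (h2.imp fun n hn => hs.trans_lt hn)

end

section

variable {E : Type*}

/-! ### The hitting time of a stopping set -/

lemma hittingTime_le_iff (T : ℝ≥0) (D : Set (ℝ≥0 × E)) (ω : Path E) (n : ℕ) :
    hittingTime T D ω ≤ n ↔ ∃ k ≤ n,
      (jumpTime k ω ≤ T ∧ (T - jumpTime k ω, state k ω) ∈ D) ∨ T ≤ jumpTime k ω := by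
  have key : ∀ P : ℕ → Prop, (⨅ (k : ℕ) (_ : P k), (k : ℕ∞)) ≤ n ↔ ∃ k ≤ n, P k := fun P => by
    rw [← ENat.lt_add_one_iff (ENat.natCast_ne_top n)]
    simp only [iInf_lt_iff, exists_prop]
    refine exists_congr fun k => ?_
    rw [ENat.lt_add_one_iff (ENat.natCast_ne_top n), Nat.cast_le, and_comm]
  rw [hittingTime, inf_le_iff, key, key, ← exists_or]
  simp only [and_or_left]

lemma hittingTime_cons_eq_zero (s : ℝ≥0) (D : Set (ℝ≥0 × E)) (x : E) (t : ℝ≥0) (ω : Path E)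
    (h : (s, x) ∈ D) : hittingTime s D (Path.cons x t ω) = 0 := by
  rw [← nonpos_iff_eq_zero, ← Nat.cast_zero, hittingTime_le_iff]
  exact ⟨0, le_rfl, Or.inl (by simpa using h)⟩

/-- If the hitting time does not stop at once, then after the first jump it is the hitting time for
the remaining horizon, also if that jump is beyond the horizon, when `s - t = 0`. -/
lemma hittingTime_cons (s : ℝ≥0) (D : Set (ℝ≥0 × E)) (x : E) (t : ℝ≥0) (ω : Path E)
    (hs : s ≠ 0) (h : (s, x) ∉ D) :
    hittingTime s D (Path.cons x t ω) = hittingTime (s - t) D ω + 1 := by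
  have key : ∀ k, ((jumpTime (k + 1) (Path.cons x t ω) ≤ s ∧
      (s - jumpTime (k + 1) (Path.cons x t ω), state (k + 1) (Path.cons x t ω)) ∈ D) ∨
        s ≤ jumpTime (k + 1) (Path.cons x t ω)) ↔
      ((jumpTime k ω ≤ s - t ∧ (s - t - jumpTime k ω, state k ω) ∈ D) ∨
        s - t ≤ jumpTime k ω) := fun k => by
    rw [jumpTime_succ_cons, state_succ_cons, ← tsub_add_eq_tsub_tsub, tsub_le_iff_left]
    rcases le_total t s with hts | hts
    · rw [le_tsub_iff_left hts]
    · have : s ≤ t + jumpTime k ω := hts.trans le_self_add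
      simp [this]
  have hle : ∀ n : ℕ, hittingTime s D (Path.cons x t ω) ≤ n ↔
      hittingTime (s - t) D ω + 1 ≤ n := fun n => by
    rw [hittingTime_le_iff]
    cases n with
    | zero => simp [h, hs]
    | succ n =>
      rw [Nat.cast_succ, ENat.add_le_add_iff_right ENat.one_ne_top, hittingTime_le_iff]
      constructor
      · rintro ⟨k, hk, hP⟩
        cases k with
        | zero => simp [h, hs] at hP
        | succ k => exact ⟨k, by omega, (key k).1 hP⟩
      · rintro ⟨k, hk, hP⟩
        exact ⟨k + 1, by omega, (key k).2 hP⟩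
  have le_of_forall : ∀ a b : ℕ∞, (∀ n : ℕ, b ≤ n → a ≤ n) → a ≤ b := fun a b hab => by
    induction b using ENat.recTopCoe with
    | top => exact le_top
    | coe n => exact hab n le_rfl
  exact le_antisymm (le_of_forall _ _ fun n => (hle n).2) (le_of_forall _ _ fun n => (hle n).1)

variable [MeasurableSpace E]

/-! ### The optimality operator -/

/-- The cost of not stopping in `(s, x)` when `u` is the cost after the next jump: the first
argument of the minimum in `opG`, with `∫₀ˢ (1 - Q(t, E | x)) dt` written as the mean of
`T₁ ∧ s`. -/
noncomputable def contCost (K : SemiMarkovKernel E) (c : E → ℝ≥0) (u : ℝ≥0 → E → ℝ≥0∞)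
    (s : ℝ≥0) (x : E) : ℝ≥0∞ :=
  (c x : ℝ≥0∞) * (∫⁻ p, (min p.1 s : ℝ≥0) ∂(K.kernel x))
    + ∫⁻ p in {p : ℝ≥0 × E | p.1 ≤ s}, u (s - p.1) p.2 ∂(K.kernel x)

lemma measurableSet_fst_le (s : ℝ≥0) : MeasurableSet {p : ℝ≥0 × E | p.1 ≤ s} :=
  measurableSet_le measurable_fst measurable_const

lemma lintegral_survival (K : SemiMarkovKernel E) (s : ℝ≥0) (x : E) :
    ∫⁻ t in Set.Icc (0 : ℝ) s, (1 - K.Q t Set.univ x) =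
      ∫⁻ p, (min p.1 s : ℝ≥0) ∂(K.kernel x) := by
  have h1 : ∀ t : ℝ, 1 - K.Q t Set.univ x =
      ∫⁻ p, {q : ℝ × ℝ≥0 × E | q.1 < q.2.1}.indicator 1 (t, p) ∂(K.kernel x) := fun t => by
    have hm : MeasurableSet {p : ℝ≥0 × E | (p.1 : ℝ) ≤ t ∧ p.2 ∈ (Set.univ : Set E)} := by
      simpa using measurableSet_le measurable_fst.coe_nnreal_real measurable_const
    rw [SemiMarkovKernel.Q, ← prob_compl_eq_one_sub hm, ← lintegral_indicator_one hm.compl]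
    refine lintegral_congr fun p => ?_
    by_cases h : t < p.1 <;> simp [Set.indicator, h]
  have hm : MeasurableSet {q : ℝ × ℝ≥0 × E | q.1 < q.2.1} :=
    measurableSet_lt measurable_fst measurable_snd.fst.coe_nnreal_real
  simp only [h1]
  -- Tonelli: `∫₀ˢ ℙ(t < T₁) dt` is the mean of the length of `[0, s) ∩ [0, T₁)`.
  rw [← restrict_Ico_eq_restrict_Icc, lintegral_lintegral_swap]
  · refine lintegral_congr fun p => ?_
    have h2 : ∀ t : ℝ, {q : ℝ × ℝ≥0 × E | q.1 < q.2.1}.indicator (1 : ℝ × ℝ≥0 × E → ℝ≥0∞) (t, p) =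
        (Set.Iio (p.1 : ℝ)).indicator 1 t := fun t => by
      by_cases h : t < p.1 <;> simp [Set.indicator, h]
    simp only [h2]
    rw [lintegral_indicator_one measurableSet_Iio, Measure.restrict_apply measurableSet_Iio,
      Set.inter_comm, Set.Ico_inter_Iio, Real.volume_Ico, sub_zero, min_comm, ← NNReal.coe_min,
      ENNReal.ofReal_coe_nnreal]
  · exact (measurable_one.indicator hm).aemeasurable

lemma opG_eq (K : SemiMarkovKernel E) (c g : E → ℝ≥0) (u : ℝ≥0 → E → ℝ≥0∞) (s : ℝ≥0) (x : E) :
    opG K c g u s x = min (contCost K c u s x) (g x) := by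
  rw [opG, lintegral_survival, contCost]

lemma opG_mono (K : SemiMarkovKernel E) (c g : E → ℝ≥0) {u v : ℝ≥0 → E → ℝ≥0∞} (h : u ≤ v) :
    opG K c g u ≤ opG K c g v := fun _ _ =>
  min_le_min_right _ (add_le_add le_rfl (lintegral_mono fun _ => h _ _))

lemma opG_le (K : SemiMarkovKernel E) (c g : E → ℝ≥0) (u : ℝ≥0 → E → ℝ≥0∞) (s : ℝ≥0) (x : E) :
    opG K c g u s x ≤ g x := min_le_right _ _

lemma monotone_valueIter (K : SemiMarkovKernel E) (c g : E → ℝ≥0) :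
    Monotone (valueIter K c g) := by
  refine monotone_nat_of_le_succ fun n => ?_
  induction n with
  | zero => exact fun _ _ => bot_le
  | succ n ih => exact opG_mono K c g ih

lemma measurable_contCost (K : SemiMarkovKernel E) {c : E → ℝ≥0} (hc : Measurable c)
    {u : ℝ≥0 → E → ℝ≥0∞} (hu : Measurable fun q : ℝ≥0 × E => u q.1 q.2) :
    Measurable fun q : ℝ≥0 × E => contCost K c u q.1 q.2 := by
  have key : ∀ Φ : (ℝ≥0 × E) × (ℝ≥0 × E) → ℝ≥0∞, Measurable Φ →
      Measurable fun q : ℝ≥0 × E => ∫⁻ p, Φ (q, p) ∂(K.kernel q.2) := fun Φ hΦ =>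
    Measurable.lintegral_kernel_prod_right' (κ := K.kernel.comap Prod.snd measurable_snd) hΦ
  refine ((hc.comp measurable_snd).coe_nnreal_ennreal.mul
    (key (fun q => ((min q.2.1 q.1.1 : ℝ≥0) : ℝ≥0∞)) (by fun_prop))).add ?_
  have hm : MeasurableSet {q : (ℝ≥0 × E) × (ℝ≥0 × E) | q.2.1 ≤ q.1.1} :=
    measurableSet_le measurable_snd.fst measurable_fst.fst
  have hφ : Measurable fun q : (ℝ≥0 × E) × (ℝ≥0 × E) => u (q.1.1 - q.2.1) q.2.2 :=
    hu.comp ((measurable_fst.fst.sub measurable_snd.fst).prodMk measurable_snd.snd)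
  convert key _ (hφ.indicator hm) using 2 with q
  rw [← lintegral_indicator (measurableSet_fst_le _)]
  rfl

lemma measurable_opG (K : SemiMarkovKernel E) {c g : E → ℝ≥0} (hc : Measurable c)
    (hg : Measurable g) {u : ℝ≥0 → E → ℝ≥0∞} (hu : Measurable fun q : ℝ≥0 × E => u q.1 q.2) :
    Measurable fun q : ℝ≥0 × E => opG K c g u q.1 q.2 := by
  simp only [opG_eq]
  exact (measurable_contCost K hc hu).min (hg.comp measurable_snd).coe_nnreal_ennreal

lemma measurable_valueIter (K : SemiMarkovKernel E) {c g : E → ℝ≥0} (hc : Measurable c)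
    (hg : Measurable g) (n : ℕ) : Measurable fun q : ℝ≥0 × E => valueIter K c g n q.1 q.2 := by
  induction n with
  | zero => exact measurable_const
  | succ n ih => exact measurable_opG K hc hg ih

lemma measurableSet_stopSet (K : SemiMarkovKernel E) {c g : E → ℝ≥0} (hc : Measurable c)
    (hg : Measurable g) (T : ℝ≥0) (N : ℕ) : MeasurableSet (stopSet K c g T N) :=
  (measurable_fst measurableSet_Ioc).inter
    (measurableSet_eq_fun (hg.comp measurable_snd).coe_nnreal_ennreal
      (measurable_opG K hc hg (measurable_valueIter K hc hg N)))

/-- A jump occurs before the horizon with probability at most `b`, so that `contCost` is a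
contraction with factor `b` in `u`. -/
lemma contCost_le_add (K : SemiMarkovKernel E) (c : E → ℝ≥0) {T : ℝ≥0} {b : ℝ≥0∞}
    (hK : ∀ x, K.kernel x {p | p.1 ≤ T} ≤ b) {u v : ℝ≥0 → E → ℝ≥0∞} {r : ℝ≥0∞}
    (h : ∀ s ≤ T, ∀ x, u s x ≤ v s x + r) {s : ℝ≥0} (hs : s ≤ T) (x : E) :
    contCost K c u s x ≤ contCost K c v s x + b * r := by
  rw [contCost, contCost, add_assoc]
  gcongr
  calc ∫⁻ p in {p : ℝ≥0 × E | p.1 ≤ s}, u (s - p.1) p.2 ∂(K.kernel x)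
      ≤ ∫⁻ p in {p : ℝ≥0 × E | p.1 ≤ s}, (v (s - p.1) p.2 + r) ∂(K.kernel x) :=
        lintegral_mono fun p => h _ (tsub_le_self.trans hs) _
    _ = ∫⁻ p in {p : ℝ≥0 × E | p.1 ≤ s}, v (s - p.1) p.2 ∂(K.kernel x)
        + r * K.kernel x {p | p.1 ≤ s} := by
        rw [lintegral_add_right _ measurable_const, setLIntegral_const]
    _ ≤ _ := by
        rw [mul_comm r]
        gcongr
        exact (measure_mono fun p hp => le_trans hp hs).trans (hK x)

/-- All iterates, later ones in particular, exceed the `n`-th by at most `b ^ n * G`. -/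
lemma valueIter_le_add (K : SemiMarkovKernel E) (c g : E → ℝ≥0) {T : ℝ≥0} {b : ℝ≥0∞}
    (hK : ∀ x, K.kernel x {p | p.1 ≤ T} ≤ b) {G : ℝ≥0} (hG : ∀ x, g x ≤ G) (m n : ℕ)
    (s : ℝ≥0) (hs : s ≤ T) (x : E) :
    valueIter K c g m s x ≤ valueIter K c g n s x + b ^ n * G := by
  induction n generalizing m s x with
  | zero =>
    cases m with
    | zero => exact bot_le
    | succ m =>
      refine (opG_le ..).trans ?_
      simpa [valueIter] using hG x
  | succ n ih =>
    cases m with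
    | zero => exact bot_le
    | succ m =>
      rw [valueIter, valueIter, opG_eq, opG_eq, min_add]
      refine min_le_min ?_ le_self_add
      rw [pow_succ', mul_assoc]
      exact contCost_le_add K c hK (fun s hs x => ih m s hs x) hs x

/-! ### Stopping times after the first jump -/

lemma measurable_history (k n : ℕ) (h : k ≤ n) :
    Measurable[historyFiltration E n] fun ω : Path E => (sojourn k ω, state k ω) :=
  measurable_iff_comap_le.2 (le_iSup₂_of_le (f := fun k (_ : k ≤ n) =>
    MeasurableSpace.comap (fun ω : Path E => (sojourn k ω, state k ω)) inferInstance) k h le_rfl)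

lemma measurable_cons_history (x : E) (t : ℝ≥0) (n : ℕ) :
    @Measurable _ _ (historyFiltration E n) (historyFiltration E (n + 1)) (Path.cons x t) := by
  rw [measurable_iff_comap_le]
  change MeasurableSpace.comap _ (⨆ k ≤ n + 1, _) ≤ _
  simp only [MeasurableSpace.comap_iSup, MeasurableSpace.comap_comp]
  refine iSup₂_le fun k hk => measurable_iff_comap_le.1 ?_
  match k, hk with
  | 0, _ =>
    exact show Measurable[historyFiltration E n] fun _ : Path E => ((0 : ℝ≥0), x) from
      measurable_const
  | 1, _ =>
    have h : Measurable[historyFiltration E n] (state 0 : Path E → E) :=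
      measurable_snd.comp (measurable_history 0 n (Nat.zero_le n))
    exact show Measurable[historyFiltration E n] fun ω : Path E => (t, state 0 ω) from
      measurable_const.prodMk h
  | k + 2, hk => exact measurable_history (k + 1) n (by omega)

/-- The remaining number of jumps after a first jump from `x` at time `t` is a stopping time of
the path that starts afresh. -/
lemma isStoppingTime_cons {τ : Path E → ℕ∞} (hτ : IsStoppingTime (historyFiltration E) τ)
    (x : E) (t : ℝ≥0) :
    IsStoppingTime (historyFiltration E) (fun ω => τ (Path.cons x t ω) - 1 : Path E → ℕ∞) := by
  intro n
  have h := measurable_cons_history x t n (hτ (n + 1))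
  convert h using 1
  ext ω
  change τ (Path.cons x t ω) - 1 ≤ (n : ℕ∞) ↔ τ (Path.cons x t ω) ≤ ((n + 1 : ℕ) : ℕ∞)
  rw [tsub_le_iff_right]
  norm_cast

/-- Whether a stopping time stops at once depends on the initial state only. -/
lemma stoppingTime_cons_eq_zero {τ : Path E → ℕ∞}
    (hτ : IsStoppingTime (historyFiltration E) τ) (x : E) {t t' : ℝ≥0} {ω ω' : Path E}
    (h : τ (Path.cons x t ω) = 0) : τ (Path.cons x t' ω') = 0 := by
  have hle : historyFiltration E 0 ≤
      MeasurableSpace.comap (fun ω : Path E => (sojourn 0 ω, state 0 ω)) inferInstance :=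
    iSup₂_le fun k hk => by obtain rfl := Nat.le_zero.1 hk; exact le_rfl
  obtain ⟨B, -, hB⟩ := hle _ (hτ 0)
  have h1 : Path.cons x t ω ∈ {ω | τ ω ≤ ((0 : ℕ) : ℕ∞)} := by simp [h]
  have h2 : Path.cons x t' ω' ∈ {ω | τ ω ≤ ((0 : ℕ) : ℕ∞)} := by
    have h1' : Path.cons x t ω ∈ (fun ω : Path E => (sojourn 0 ω, state 0 ω)) ⁻¹' B := hB ▸ h1
    have h2' : Path.cons x t' ω' ∈ (fun ω : Path E => (sojourn 0 ω, state 0 ω)) ⁻¹' B := h1'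
    exact hB ▸ h2'
  simpa using h2

section expectation

variable [MeasurableSingletonClass E] (K : SemiMarkovKernel E) {c g : E → ℝ≥0}

lemma lintegral_stepCost_of_eq_zero (hc : Measurable c) (hg : Measurable g) (s : ℝ≥0)
    {τ : Path E → ℕ∞} (hτ : IsStoppingTime (historyFiltration E) τ) (x : E)
    (h : ∀ t ω, τ (Path.cons x t ω) = 0) :
    ∫⁻ ω, stepCost c g s τ ω ∂(K.law x) = if 0 < s then (g x : ℝ≥0∞) else 0 := by
  rw [K.lintegral_law _ _ (measurable_stepCost hc hg s hτ)]
  simp [stepCost_of_eq_zero _ _ _ _ _ (h _ _)]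

lemma lintegral_stepCost_of_eq_add_one (hc : Measurable c) (hg : Measurable g) (s : ℝ≥0)
    {τ : Path E → ℕ∞} (hτ : IsStoppingTime (historyFiltration E) τ) (x : E)
    (τ' : ℝ≥0 → Path E → ℕ∞) (h : ∀ t ω, τ (Path.cons x t ω) = τ' t ω + 1) :
    ∫⁻ ω, stepCost c g s τ ω ∂(K.law x) =
      (c x : ℝ≥0∞) * (∫⁻ p, (min p.1 s : ℝ≥0) ∂(K.kernel x))
        + ∫⁻ p in {p : ℝ≥0 × E | p.1 ≤ s},
            ∫⁻ ω, stepCost c g (s - p.1) (τ' p.1) ω ∂(K.law p.2) ∂(K.kernel x) := by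
  have hm : Measurable fun p : ℝ≥0 × E => ((min p.1 s : ℝ≥0) : ℝ≥0∞) := by fun_prop
  rw [K.lintegral_law _ _ (measurable_stepCost hc hg s hτ), ← lintegral_const_mul _ hm,
    ← lintegral_indicator (measurableSet_fst_le s), ← lintegral_add_left (hm.const_mul _)]
  refine lintegral_congr fun p => ?_
  have h1 : ∀ ω, stepCost c g s τ (Path.cons x p.1 ω) =
      (c x : ℝ≥0∞) * (min p.1 s : ℝ≥0) + stepCost c g (s - p.1) (τ' p.1) ω :=
    fun ω => stepCost_cons _ _ _ _ _ _ _ _ (h _ _)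
  simp only [h1]
  rw [lintegral_add_left measurable_const, lintegral_const, measure_univ, mul_one]
  congr 1
  by_cases hp : p.1 ≤ s
  · rw [Set.indicator_of_mem (by exact hp)]
  · rw [Set.indicator_of_notMem (by exact hp), tsub_eq_zero_of_le (not_le.1 hp).le]
    simp [stepCost_zero]

/-- No stopping time beats the value iterates: by the first-step decomposition, the cost of `τ`
with at most `n` further decisions dominates the `n`-fold application of `opG` to `0`. -/
lemma valueIter_le_lintegral_stepCost (hc : Measurable c) (hg : Measurable g) (n : ℕ) (s : ℝ≥0)
    {τ : Path E → ℕ∞} (hτ : IsStoppingTime (historyFiltration E) τ) (x : E) :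
    valueIter K c g n s x ≤ ∫⁻ ω, stepCost c g s τ ω ∂(K.law x) := by
  induction n generalizing s τ x with
  | zero => exact bot_le
  | succ n ih =>
    rw [valueIter, opG_eq]
    by_cases h : ∃ t ω, τ (Path.cons x t ω) = 0
    · obtain ⟨t, ω, h⟩ := h
      rw [lintegral_stepCost_of_eq_zero K hc hg s hτ x
        fun t' ω' => stoppingTime_cons_eq_zero hτ x h]
      split_ifs with hs
      · exact min_le_right _ _
      · -- At horizon `0` stopping costs nothing; neither does continuing, as `T₁ > 0`.
        refine (min_le_left _ _).trans ?_
        obtain rfl : s = 0 := by simpa using hs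
        have h0 : K.kernel x {p : ℝ≥0 × E | p.1 ≤ 0} = 0 := by simpa using K.kernel_zero x
        rw [contCost, Measure.restrict_eq_zero.2 h0]
        simp
    · push Not at h
      rw [lintegral_stepCost_of_eq_add_one K hc hg s hτ x
        (fun t ω => τ (Path.cons x t ω) - 1)
        fun t ω => (tsub_add_cancel_of_le (Order.one_le_iff_ne_zero.2 (h t ω))).symm]
      exact (min_le_left _ _).trans (add_le_add le_rfl (lintegral_mono fun p =>
        ih (s - p.1) (isStoppingTime_cons hτ x p.1) p.2))

end expectation

/-! ### The cost of hitting times -/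

lemma isStoppingTime_hittingTime (T : ℝ≥0) {D : Set (ℝ≥0 × E)} (hD : MeasurableSet D) :
    IsStoppingTime (historyFiltration E) (hittingTime T D) := by
  intro n
  have h : {ω : Path E | hittingTime T D ω ≤ (n : ℕ∞)} = ⋃ k ≤ n, {ω : Path E |
      (jumpTime k ω ≤ T ∧ (T - jumpTime k ω, state k ω) ∈ D) ∨ T ≤ jumpTime k ω} := by
    ext ω
    simp [hittingTime_le_iff]
  change MeasurableSet[historyFiltration E n] {ω : Path E | hittingTime T D ω ≤ (n : ℕ∞)}
  rw [h]
  refine MeasurableSet.iUnion fun k => MeasurableSet.iUnion fun hk => ?_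
  have hS : Measurable[historyFiltration E n] (jumpTime k : Path E → ℝ≥0) :=
    Finset.measurable_sum _ fun j hj => measurable_fst.comp
      (measurable_history j n ((Nat.lt_succ_iff.1 (Finset.mem_range.1 hj)).trans hk))
  have hX : Measurable[historyFiltration E n] (state k : Path E → E) :=
    measurable_snd.comp (measurable_history k n hk)
  exact ((hS measurableSet_Iic).inter (((measurable_const.sub hS).prodMk hX) hD)).union
    (hS measurableSet_Ici)

/-- The expected cost up to the horizon `s` of stopping as soon as the remaining time and the
current state are in `D`. -/
noncomputable def hittingCost (K : SemiMarkovKernel E) (c g : E → ℝ≥0) (D : Set (ℝ≥0 × E))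
    (s : ℝ≥0) (x : E) : ℝ≥0∞ :=
  ∫⁻ ω, stepCost c g s (hittingTime s D) ω ∂(K.law x)

lemma hittingCost_zero (K : SemiMarkovKernel E) (c g : E → ℝ≥0) (D : Set (ℝ≥0 × E)) (x : E) :
    hittingCost K c g D 0 x = 0 := by
  simp [hittingCost, stepCost_zero]

/-- An inequality because of `s = 0`, where the terminal cost is not charged. -/
lemma hittingCost_le_of_mem [MeasurableSingletonClass E] (K : SemiMarkovKernel E) {c g : E → ℝ≥0}
    (hc : Measurable c) (hg : Measurable g) {D : Set (ℝ≥0 × E)} (hD : MeasurableSet D) {s : ℝ≥0}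
    {x : E} (h : (s, x) ∈ D) : hittingCost K c g D s x ≤ g x := by
  rw [hittingCost, lintegral_stepCost_of_eq_zero K hc hg s (isStoppingTime_hittingTime s hD) x
    fun t ω => hittingTime_cons_eq_zero s D x t ω h]
  split_ifs <;> simp

lemma hittingCost_eq_contCost [MeasurableSingletonClass E] (K : SemiMarkovKernel E)
    {c g : E → ℝ≥0} (hc : Measurable c) (hg : Measurable g) {D : Set (ℝ≥0 × E)}
    (hD : MeasurableSet D) {s : ℝ≥0} {x : E} (hs : s ≠ 0) (h : (s, x) ∉ D) :
    hittingCost K c g D s x = contCost K c (hittingCost K c g D) s x :=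
  lintegral_stepCost_of_eq_add_one K hc hg s (isStoppingTime_hittingTime s hD) x
    (fun t => hittingTime (s - t) D) fun t ω => hittingTime_cons s D x t ω hs h

end

section

variable {E : Type*} [MeasurableSpace E]

/-! ### Error bounds -/

lemma opG_eq_contCost_of_notMem (K : SemiMarkovKernel E) {c g : E → ℝ≥0} {T : ℝ≥0}
    {N : ℕ} {s : ℝ≥0} {x : E} (hs0 : s ≠ 0) (hs : s ≤ T)
    (h : (s, x) ∉ stopSet K c g T N) :
    opG K c g (valueIter K c g N) s x = contCost K c (valueIter K c g N) s x := by
  have h1 : (g x : ℝ≥0∞) ≠ opG K c g (valueIter K c g N) s x := fun h2 =>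
    h ⟨⟨pos_iff_ne_zero.2 hs0, hs⟩, h2⟩
  rw [opG_eq] at h1 ⊢
  rcases min_choice (contCost K c (valueIter K c g N) s x) (g x : ℝ≥0∞) with h2 | h2
  · exact h2
  · exact absurd h2.symm h1

lemma le_of_forall_le_add_pow_mul {b : ℝ≥0∞} (hb : b < 1) {B : ℝ≥0∞} (hB : B ≠ ⊤) {u v : ℝ≥0∞}
    (h : ∀ k : ℕ, u ≤ v + b ^ k * B) : u ≤ v := by
  have h1 : Filter.Tendsto (fun k : ℕ => v + b ^ k * B) Filter.atTop (nhds (v + 0 * B)) :=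
    tendsto_const_nhds.add (ENNReal.Tendsto.mul_const
      (ENNReal.tendsto_pow_atTop_nhds_zero_of_lt_one hb) (Or.inr hB))
  simpa using ge_of_tendsto' h1 h

section bounds

variable [MeasurableSingletonClass E] (K : SemiMarkovKernel E) {c g : E → ℝ≥0} {T : ℝ≥0}
  {b : ℝ≥0∞}

lemma valueIter_le_value (hc : Measurable c) (hg : Measurable g) (hb : b < 1)
    (hK : ∀ x, K.kernel x {p | p.1 ≤ T} ≤ b) (n : ℕ) (x : E) :
    valueIter K c g n T x ≤ value K c g T x :=
  le_iInf₂ fun τ hτ => by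
    rw [expectedCost_eq_lintegral_stepCost K c g T b hb hK τ T le_rfl x]
    exact valueIter_le_lintegral_stepCost K hc hg n T hτ x

lemma expectedCost_hittingTime (hb : b < 1) (hK : ∀ x, K.kernel x {p | p.1 ≤ T} ≤ b)
    (D : Set (ℝ≥0 × E)) {s : ℝ≥0} (hs : s ≤ T) (x : E) :
    expectedCost K c g (hittingTime s D) s x = hittingCost K c g D s x :=
  expectedCost_eq_lintegral_stepCost K c g T b hb hK _ s hs x

lemma hittingCost_le (hb : b < 1) (hK : ∀ x, K.kernel x {p | p.1 ≤ T} ≤ b)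
    (D : Set (ℝ≥0 × E)) {C G : ℝ≥0} (hC : ∀ x, c x ≤ C) (hG : ∀ x, g x ≤ G) {s : ℝ≥0}
    (hs : s ≤ T) (x : E) : hittingCost K c g D s x ≤ C * T + G := by
  rw [← expectedCost_hittingTime K hb hK D hs]
  calc expectedCost K c g (hittingTime s D) s x
      ≤ ∫⁻ _, (C * s + G : ℝ≥0∞) ∂(K.law x) :=
        lintegral_mono fun ω => pathCost_le c g C G hC hG s _ ω
    _ = C * s + G := by simp
    _ ≤ C * T + G := by gcongr

/-- The cost of the hitting time exceeds the iterate that defines the stopping set by at most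
`ε`. Off the stopping set both satisfy a one-step equation, and the two right-hand sides differ by
at most `b` times the supremal excess plus the error `b ^ N * G` of the `N`-th iterate. -/
lemma hittingCost_le_valueIter_add (hc : Measurable c) (hg : Measurable g) (hb : b < 1)
    (hK : ∀ x, K.kernel x {p | p.1 ≤ T} ≤ b) {C G : ℝ≥0} (hC : ∀ x, c x ≤ C)
    (hG : ∀ x, g x ≤ G) {N : ℕ} {ε : ℝ≥0∞} (hε : b * (ε + b ^ N * G) ≤ ε) {s : ℝ≥0}
    (hs : s ≤ T) (x : E) :
    hittingCost K c g (stopSet K c g T N) s x ≤ valueIter K c g (N + 1) s x + ε := by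
  set D := stopSet K c g T N with hD
  have hDm : MeasurableSet D := measurableSet_stopSet K hc hg T N
  set B : ℝ≥0∞ := C * T + G
  have hB : B ≠ ⊤ := by simp [B, ENNReal.mul_eq_top]
  refine le_of_forall_le_add_pow_mul hb hB fun k => ?_
  induction k generalizing s x with
  | zero =>
    rw [pow_zero, one_mul]
    exact (hittingCost_le K hb hK D hC hG hs x).trans le_add_self
  | succ k ih =>
    rcases eq_or_ne s 0 with rfl | hs0
    · rw [hittingCost_zero]
      exact bot_le
    by_cases hx : (s, x) ∈ D
    · refine (hittingCost_le_of_mem K hc hg hDm hx).trans ?_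
      rw [hx.2, add_assoc]
      exact le_self_add
    · rw [hittingCost_eq_contCost K hc hg hDm hs0 hx, valueIter,
        opG_eq_contCost_of_notMem K hs0 hs hx]
      -- The induction hypothesis, with the iterate `N + 1` replaced by the iterate `N`.
      have h1 : ∀ s ≤ T, ∀ x, hittingCost K c g D s x ≤
          valueIter K c g N s x + (b ^ k * B + (ε + b ^ N * G)) := fun s hs x => by
        refine (ih hs x).trans ((add_le_add_left (add_le_add_left
          (valueIter_le_add K c g hK hG (N + 1) N s hs x) _) _).trans (le_of_eq ?_))
        ring
      refine (contCost_le_add K c hK h1 hs x).trans ?_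
      rw [mul_add, ← mul_assoc, ← pow_succ', add_assoc,
        add_comm ε (b ^ (k + 1) * B)]
      gcongr

/-- If stopping costs at least `ε` more than the iterate at all points off the stopping set, with
`ε` above the error of the iterate, then continuing is optimal there, and the stopping set is the
optimal one. -/
lemma hittingCost_le_value (hc : Measurable c) (hg : Measurable g) (hb : b < 1)
    (hK : ∀ x, K.kernel x {p | p.1 ≤ T} ≤ b) {C G : ℝ≥0} (hC : ∀ x, c x ≤ C)
    (hG : ∀ x, g x ≤ G) {N : ℕ} {ε : ℝ≥0∞} (hε : b * (ε + b ^ N * G) ≤ ε)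
    (hgap : ∀ s ≤ T, s ≠ 0 → ∀ x, (s, x) ∉ stopSet K c g T N →
      opG K c g (valueIter K c g N) s x + ε ≤ g x) (x : E) :
    hittingCost K c g (stopSet K c g T N) T x ≤ value K c g T x := by
  set D := stopSet K c g T N with hD
  have hDm : MeasurableSet D := measurableSet_stopSet K hc hg T N
  set B : ℝ≥0∞ := C * T + G
  have hB : B ≠ ⊤ := by simp [B, ENNReal.mul_eq_top]
  have key : ∀ k, ∀ s ≤ T, ∀ x,
      hittingCost K c g D s x ≤ valueIter K c g (N + 1 + k) s x + b ^ k * B := by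
    intro k
    induction k with
    | zero =>
      intro s hs x
      rw [pow_zero, one_mul]
      exact (hittingCost_le K hb hK D hC hG hs x).trans le_add_self
    | succ k ih =>
      intro s hs x
      rcases eq_or_ne s 0 with rfl | hs0
      · rw [hittingCost_zero]
        exact bot_le
      by_cases hx : (s, x) ∈ D
      · refine (hittingCost_le_of_mem K hc hg hDm hx).trans ?_
        rw [hx.2]
        exact (monotone_valueIter K c g (by omega : N + 1 ≤ N + 1 + (k + 1)) s x).trans
          le_self_add
      · -- By the gap, continuing is cheaper than stopping for the later iterates as well.
        have h1 : contCost K c (valueIter K c g (N + 1 + k)) s x ≤ g x := by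
          refine (contCost_le_add K c hK (valueIter_le_add K c g hK hG (N + 1 + k) N) hs x).trans
            (le_trans ?_ (hgap s hs hs0 x hx))
          rw [opG_eq_contCost_of_notMem K hs0 hs hx]
          gcongr
          exact le_trans (by gcongr; exact le_add_self) hε
        rw [hittingCost_eq_contCost K hc hg hDm hs0 hx, ← add_assoc, valueIter, opG_eq,
          min_eq_left h1, pow_succ', mul_assoc]
        exact contCost_le_add K c hK ih hs x
  refine le_of_forall_le_add_pow_mul hb hB fun k => (key k T le_rfl x).trans ?_
  gcongr
  exact valueIter_le_value K hc hg hb hK _ x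

end bounds

/-- The choice of `N` makes the error of the `N`-th iterate small. For `β = 0` the value of `N` is
irrelevant, so that `log 0 = 0` and the division by it do no harm. -/
lemma mul_add_pow_mul_le_of_ceil_log_le {β ε M G : ℝ} {N : ℕ} (hβ0 : 0 ≤ β) (hβ1 : β < 1)
    (hε : 0 < ε) (hG0 : 0 ≤ G) (hGM : G ≤ M)
    (hN : N = ⌈(Real.log (ε * (1 - β)) - Real.log (M + 1)) / Real.log β⌉₊) :
    β * (ε + β ^ N * G) ≤ ε := by
  rcases hβ0.eq_or_lt with rfl | hβ
  · simpa using hε.le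
  have hlog : Real.log β < 0 := Real.log_neg hβ hβ1
  have h1 : (Real.log (ε * (1 - β)) - Real.log (M + 1)) / Real.log β ≤ N :=
    hN ▸ Nat.le_ceil _
  have hM : 0 < M + 1 := by linarith
  have hε' : 0 < ε * (1 - β) := mul_pos hε (by linarith)
  rw [div_le_iff_of_neg hlog] at h1
  have h2 : β ^ N * (M + 1) ≤ ε * (1 - β) := by
    rw [← Real.log_le_log_iff (by positivity) hε', Real.log_mul (by positivity) hM.ne',
      Real.log_pow]
    linarith
  have h3 : β ^ N * G ≤ β ^ N * (M + 1) :=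
    mul_le_mul_of_nonneg_left (by linarith) (by positivity)
  nlinarith [mul_le_mul_of_nonneg_left (h3.trans h2) hβ0]

end

end SemiMarkovStopping

open SemiMarkovStopping in
theorem mainTheorem7 {E : Type*} [MeasurableSpace E] [StandardBorelSpace E]
    (K : SemiMarkovKernel E) (c g : E → ℝ≥0) (hc : Measurable c) (hg : Measurable g)
    (hcb : BddAbove (Set.range c)) (hgb : BddAbove (Set.range g))
    (T : ℝ≥0) (β : ℝ) (hβ : β = ⨆ x, (K.Q T Set.univ x).toReal) (hβ_lt : β < 1)
    (ε : ℝ) (hε : 0 < ε)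
    (M : ℝ) (hM : M = T * (⨆ x, (c x : ℝ)) + ⨆ x, (g x : ℝ))
    (N : ℕ) (hN : N = ⌈(Real.log (ε * (1 - β)) - Real.log (M + 1)) / Real.log β⌉₊) :
    IsEpsOptimal K c g T ε (hittingTime T (stopSet K c g T N)) ∧
      ((ε : EReal) < ⨅ p ∈ (Set.Ioc 0 T ×ˢ (Set.univ : Set E)) \ stopSet K c g T N,
          (((g p.2 : ℝ≥0∞) : EReal) - (opG K c g (valueIter K c g N) p.1 p.2 : EReal)) →
        IsOptimal K c g T (hittingTime T (stopSet K c g T N))) := by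
  have hQ : ∀ x, K.Q T Set.univ x = K.kernel x {p | p.1 ≤ T} := fun x => by
    simp [SemiMarkovKernel.Q]
  have hβ0 : 0 ≤ β := hβ ▸ Real.iSup_nonneg fun x => ENNReal.toReal_nonneg
  have hK : ∀ x, K.kernel x {p | p.1 ≤ T} ≤ ENNReal.ofReal β := fun x => by
    rw [← ENNReal.ofReal_toReal (measure_ne_top (K.kernel x) _)]
    refine ENNReal.ofReal_le_ofReal ?_
    rw [hβ, ← hQ]
    refine le_ciSup (f := fun x => (K.Q T Set.univ x).toReal) ⟨1, ?_⟩ x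
    rintro _ ⟨y, rfl⟩
    simp only [hQ]
    exact measureReal_le_one
  have hb : ENNReal.ofReal β < 1 := by simpa using hβ_lt
  set C : ℝ≥0 := ⨆ x, c x
  set G : ℝ≥0 := ⨆ x, g x with hGdef
  have hC : ∀ x, c x ≤ C := le_ciSup hcb
  have hG : ∀ x, g x ≤ G := le_ciSup hgb
  have hGM : (G : ℝ) ≤ M := by
    rw [hM, ← NNReal.coe_iSup, ← NNReal.coe_iSup]
    exact le_add_of_nonneg_left (by positivity)
  have herr : ENNReal.ofReal β * (ENNReal.ofReal ε + ENNReal.ofReal β ^ N * G) ≤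
      ENNReal.ofReal ε := by
    rw [← ENNReal.ofReal_coe_nnreal, ← ENNReal.ofReal_pow hβ0,
      ← ENNReal.ofReal_mul (by positivity), ← ENNReal.ofReal_add hε.le (by positivity),
      ← ENNReal.ofReal_mul hβ0]
    exact ENNReal.ofReal_le_ofReal
      (mul_add_pow_mul_le_of_ceil_log_le hβ0 hβ_lt hε G.2 hGM hN)
  have hτ := isStoppingTime_hittingTime T (measurableSet_stopSet K hc hg T N)
  refine ⟨⟨hτ, fun x => ?_⟩, fun hgap => ⟨hτ, fun x => le_antisymm ?_ (iInf₂_le _ hτ)⟩⟩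
  · rw [expectedCost_hittingTime K hb hK _ le_rfl]
    refine (hittingCost_le_valueIter_add K hc hg hb hK hC hG herr le_rfl x).trans ?_
    gcongr
    exact valueIter_le_value K hc hg hb hK _ x
  · rw [expectedCost_hittingTime K hb hK _ le_rfl]
    refine hittingCost_le_value K hc hg hb hK hC hG herr (fun s hs hs0 y hy => ?_) x
    have h1 := hgap.trans_le (iInf₂_le (s, y)
      ⟨⟨⟨pos_iff_ne_zero.2 hs0, hs⟩, Set.mem_univ _⟩, hy⟩)
    have hfin : opG K c g (valueIter K c g N) s y ≠ ⊤ :=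
      ne_top_of_le_ne_top ENNReal.coe_ne_top (opG_le K c g _ s y)
    simp only at h1
    lift opG K c g (valueIter K c g N) s y to ℝ≥0 using hfin with w
    have h2 : ε < (g y : ℝ) - (w : ℝ) := by
      rwa [EReal.coe_nnreal_eq_coe_real, EReal.coe_nnreal_eq_coe_real, ← EReal.coe_sub,
        EReal.coe_lt_coe_iff] at h1
    lift ε to ℝ≥0 using hε.le
    rw [ENNReal.ofReal_coe_nnreal, ← ENNReal.coe_add, ENNReal.coe_le_coe, ← NNReal.coe_le_coe,
      NNReal.coe_add]
    linarith
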